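/- Theorem 2.2. For a partition $\pi$, let $|\pi|$ be the sum of its parts and $l(\pi)$ its largest part (with $l(\emptyset)=0$). Label the cell in row $i$ and column $j$ of the Young diagram of $\pi$ by the residue of $j-i$ modulo $2$, let $r_0(\pi)$ and $r_1(\pi)$ be the numbers of cells labelled $0$ and $1$, and call $r_0(\pi)-r_1(\pi)$ the BG-rank of $\pi$ (this is the GBG-rank modulo $t$, $\sum_{j=0}^{t-1} r_j(\pi,t)\,e^{2\pi \mathrm{i} j/t}$, for $t=2$, where $r_j(\pi,t)$ is the number of cells whose label modulo $t$ is $j$). Call $\pi$ self-conjugate if its Young diagram is invariant under reflection in the main diagonal. For a non-negative integer $M$ and an integer $k$ put $$GSC_{M,2}(k,q):=\sum_{\pi} q^{|\pi|},$$ where $\pi$ runs over all self-conjugate partitions with $l(\pi)\le M$ and BG-rank equal to $k$. Then for every non-negative integer $N$, every integer $k$ and every $\nu\in\{0,1\}$, $$GSC_{2N+\nu,2}(k,q)=q^{2k^2-k}\left[\begin{matrix}2N+\nu\\N+k\end{matrix}\right]_{q^4}$$ as formal power series in $q$, where, for integers $m,n$, $\left[\begin{matrix}m\\n\end{matrix}\right]_{q}=\dfrac{(q;q)_m}{(q;q)_n(q;q)_{m-n}}$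 if $m\ge n\ge 0$ and $0$ otherwise, with $(q;q)_L=\prod_{i=1}^{L}(1-q^i)$. -/

import Mathlib

open scoped PowerSeries

noncomputable section

namespace GBGRank

/-- The number `r_i(π, t)` of cells labelled `i` in the `t`-residue diagram of the partition with
Young diagram `π`: the cell in row `a` and column `b` is labelled by the least non-negative residue
of `b - a` modulo `t`.  (Rows and columns are numbered from `0`, which does not change `b - a`.) -/
def residueCount (π : YoungDiagram) (t i : ℕ) : ℕ :=
  (π.cells.filter fun c => ((c.2 : ℤ) - (c.1 : ℤ)) % (t : ℤ) = (i : ℤ)).card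

/-- The GBG-rank of `π` modulo `t`: the sum of `r_j(π, t) ω ^ j` over `0 ≤ j < t`, where
`ω = exp (2 π i / t)`. -/
def gbgRank (π : YoungDiagram) (t : ℕ) : ℂ :=
  ∑ j ∈ Finset.range t,
    (residueCount π t j : ℂ) * Complex.exp (2 * (Real.pi : ℂ) * Complex.I / (t : ℂ)) ^ j

/-- For `t = 2` the GBG-rank is the BG-rank `r_0 - r_1`. -/
theorem gbgRank_two (π : YoungDiagram) :
    gbgRank π 2 = (residueCount π 2 0 : ℂ) - (residueCount π 2 1 : ℂ) := by
  have h : Complex.exp (2 * (Real.pi : ℂ) * Complex.I / ((2 : ℕ) : ℂ)) = -1 := by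
    rw [← Complex.exp_pi_mul_I]
    congr 1
    push_cast
    ring
  simp only [gbgRank, h, Finset.sum_range_succ, Finset.sum_range_zero]
  ring

/-- The largest part `l(π)`, i.e. the length of the first row (`0` for the empty partition). -/
def largestPart (π : YoungDiagram) : ℕ := π.rowLen 0

/-- A partition is self-conjugate if it equals its conjugate. -/
def IsSelfConjugate (π : YoungDiagram) : Prop := π = π.transpose

/-- The self-conjugate partitions with all parts at most `N` and GBG-rank modulo `t` equal
to `k`. -/
def selfConjugateSet (N t : ℕ) (k : ℤ) : Set YoungDiagram :=
  {π | IsSelfConjugate π ∧ gbgRank π t = (k : ℂ) ∧ largestPart π ≤ N}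

/-- This set is finite, so the cardinalities in `GSC` below are honest ones. -/
theorem selfConjugateSet_finite (N t : ℕ) (k : ℤ) : (selfConjugateSet N t k).Finite := by
  refine Set.Finite.of_finite_image (f := YoungDiagram.cells) ?_
    (fun a _ b _ h => YoungDiagram.ext h)
  refine Set.Finite.subset
    (Finset.finite_toSet (Finset.range N ×ˢ Finset.range N).powerset) ?_
  rintro _ ⟨π, ⟨hs, -, hl⟩, rfl⟩
  have key : ∀ c ∈ π, c.2 < N := fun c hc => by
    have h0 : (0, c.2) ∈ π := π.up_left_mem (Nat.zero_le c.1) le_rfl hc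
    exact lt_of_lt_of_le (YoungDiagram.mem_iff_lt_rowLen.mp h0) hl
  simp only [Finset.coe_powerset, Set.mem_preimage, Set.mem_powerset_iff]
  intro c hc
  have hc' : c ∈ π := hc
  have hsw : c.swap ∈ π := by
    rw [IsSelfConjugate] at hs
    rw [hs] at hc'
    exact YoungDiagram.mem_transpose.mp hc'
  simp only [Finset.coe_product, Set.mem_prod, Finset.mem_coe, Finset.mem_range]
  exact ⟨key _ hsw, key _ hc⟩

/-- The generating function `GSC_{N,t}(k, q)`, as a formal power series in `q = X`: the coefficient
of `q ^ n` is the number of self-conjugate partitions of `n` with all parts at most `N` and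
GBG-rank modulo `t` equal to `k`. -/
def GSC (N t : ℕ) (k : ℤ) : ℚ⟦X⟧ :=
  PowerSeries.mk fun n => (({π ∈ selfConjugateSet N t k | π.card = n}.ncard : ℕ) : ℚ)

/-- The `q`-shifted factorial `(a; q)_L`, the product of `1 - a q ^ k` over `0 ≤ k < L`. -/
def qPoch (a q : ℚ⟦X⟧) (L : ℕ) : ℚ⟦X⟧ := ∏ k ∈ Finset.range L, (1 - a * q ^ k)

/-- The Gaussian binomial coefficient with top `m`, bottom `n` and base `q`: it is
`(q)_m / ((q)_n (q)_{m-n})` for `m ≥ n ≥ 0` and `0` otherwise.  The base is a power series with zero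
constant term, so that the denominator has constant term `1` and is invertible. -/
def qBinom (m n : ℤ) (q : ℚ⟦X⟧) : ℚ⟦X⟧ :=
  if 0 ≤ n ∧ n ≤ m then
    qPoch q q m.toNat * (qPoch q q n.toNat * qPoch q q (m - n).toNat)⁻¹
  else 0

end GBGRank

end

namespace GBGRank

/-! ### Gaussian binomial coefficients -/

/-! Both sides satisfy the same recurrence in the bound `M` on the largest part. A self-conjugate
partition with largest part exactly `M + 1` is its principal hook, with arm and leg `M`, together
with a self-conjugate partition of largest part at most `M` moved one step down the diagonal. The
hook has `2 * M + 1` cells and BG-rank `(-1) ^ M`, and the move preserves labels, which gives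
`GSC_succ`: `GSC_{M+1}(k) = GSC_M(k) + q^(2M+1) GSC_M(k - (-1)^M)`. On the product side this is a
`q`-Pascal rule in base `q^4`. The sign makes the parity of `M` matter: the two forms of the rule
serve even and odd `M` (`X_pow_mul_qBinom_odd`, `X_pow_mul_qBinom_even`). -/

theorem qPoch_succ (a q : ℚ⟦X⟧) (L : ℕ) : qPoch a q (L + 1) = qPoch a q L * (1 - a * q ^ L) :=
  Finset.prod_range_succ _ _

theorem constantCoeff_qPoch_self {q : ℚ⟦X⟧} (hq : PowerSeries.constantCoeff q = 0) (L : ℕ) :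
    PowerSeries.constantCoeff (qPoch q q L) = 1 := by
  simp [qPoch, map_prod, hq]

theorem qBinom_eq_zero {m n : ℤ} (q : ℚ⟦X⟧) (h : ¬ (0 ≤ n ∧ n ≤ m)) : qBinom m n q = 0 :=
  if_neg h

theorem qBinom_symm (m n : ℤ) (q : ℚ⟦X⟧) : qBinom m (m - n) q = qBinom m n q := by
  unfold qBinom
  by_cases h : 0 ≤ n ∧ n ≤ m
  · rw [if_pos h, if_pos (by omega), mul_comm (qPoch q q n.toNat), sub_sub_cancel]
  · rw [if_neg h, if_neg (by omega)]

theorem qBinom_natCast_add (a b : ℕ) (q : ℚ⟦X⟧) :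
    qBinom (a + b) a q = qPoch q q (a + b) * (qPoch q q a * qPoch q q b)⁻¹ := by
  have h1 : ((a : ℤ) + b).toNat = a + b := by omega
  have h2 : ((a : ℤ) + b - a).toNat = b := by omega
  rw [qBinom, if_pos (by omega), h1, h2, Int.toNat_natCast]

theorem qBinom_zero_right (m : ℕ) {q : ℚ⟦X⟧} (hq : PowerSeries.constantCoeff q = 0) :
    qBinom m 0 q = 1 := by
  have h := qBinom_natCast_add 0 m q
  simp only [Nat.cast_zero, zero_add] at h
  rw [h, show qPoch q q 0 = 1 from rfl, one_mul]
  exact PowerSeries.mul_inv_cancel _ (by simp [constantCoeff_qPoch_self hq])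

theorem qBinom_self (m : ℕ) {q : ℚ⟦X⟧} (hq : PowerSeries.constantCoeff q = 0) :
    qBinom m m q = 1 := by
  rw [← qBinom_symm, sub_self, qBinom_zero_right m hq]

/-- Over the common denominator `(q)_{a+1} (q)_{b+1}` this is `1 - q^(a+b+2) = (1 - q^(b+1)) +
q^(b+1) (1 - q^(a+1))`. -/
theorem qBinom_pascal_aux (a b : ℕ) {q : ℚ⟦X⟧} (hq : PowerSeries.constantCoeff q = 0) :
    qBinom ((a + 1 : ℕ) + (b + 1 : ℕ)) (a + 1 : ℕ) q =
      qBinom ((a + 1 : ℕ) + b) (a + 1 : ℕ) q + q ^ (b + 1) * qBinom (a + (b + 1 : ℕ)) a q := by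
  have hc : ∀ L, PowerSeries.constantCoeff (qPoch q q L) ≠ 0 := fun L => by
    simp [constantCoeff_qPoch_self hq]
  have inv : ∀ L, qPoch q q L * (qPoch q q L)⁻¹ = 1 := fun L =>
    PowerSeries.mul_inv_cancel _ (hc L)
  rw [qBinom_natCast_add, qBinom_natCast_add, qBinom_natCast_add]
  simp only [PowerSeries.mul_inv_rev]
  have ha : (qPoch q q a)⁻¹ = (1 - q * q ^ a) * (qPoch q q (a + 1))⁻¹ := by
    have h := inv (a + 1)
    rw [qPoch_succ] at h ⊢
    linear_combination (-(qPoch q q a)⁻¹) * h +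
      (1 - q * q ^ a) * (qPoch q q a * (1 - q * q ^ a))⁻¹ * inv a
  have hb : (qPoch q q b)⁻¹ = (1 - q * q ^ b) * (qPoch q q (b + 1))⁻¹ := by
    have h := inv (b + 1)
    rw [qPoch_succ] at h ⊢
    linear_combination (-(qPoch q q b)⁻¹) * h +
      (1 - q * q ^ b) * (qPoch q q b * (1 - q * q ^ b))⁻¹ * inv b
  rw [ha, hb, show a + 1 + (b + 1) = a + b + 1 + 1 by ring, qPoch_succ q q (a + b + 1),
    show a + 1 + b = a + b + 1 by ring, show a + (b + 1) = a + b + 1 by ring]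
  ring

/-- The `q`-Pascal rule, at all integers `n`. -/
theorem qBinom_succ_left (m : ℕ) (n : ℤ) {q : ℚ⟦X⟧} (hq : PowerSeries.constantCoeff q = 0) :
    qBinom (m + 1) n q = qBinom m n q + q ^ (m + 1 - n).toNat * qBinom m (n - 1) q := by
  rcases lt_trichotomy n 0 with hn | rfl | hn
  · rw [qBinom_eq_zero, qBinom_eq_zero, qBinom_eq_zero] <;> first | omega | simp
  · rw [qBinom_zero_right m hq, qBinom_eq_zero _ (by omega : ¬ (0 ≤ (0 : ℤ) - 1 ∧ _))]
    simpa using qBinom_zero_right (m + 1) hq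
  rcases lt_trichotomy n (m + 1) with hm | rfl | hm
  · obtain ⟨a, rfl⟩ : ∃ a : ℕ, n = (a + 1 : ℕ) := ⟨(n - 1).toNat, by omega⟩
    obtain ⟨b, rfl⟩ : ∃ b : ℕ, m = a + (b + 1) := ⟨m - a - 1, by omega⟩
    have h := qBinom_pascal_aux a b hq
    have e : (((a + (b + 1) : ℕ) : ℤ) + 1 - ((a + 1 : ℕ) : ℤ)).toNat = b + 1 := by omega
    have e1 : ((a + 1 : ℕ) : ℤ) + b = (a + (b + 1) : ℕ) := by omega
    have e2 : (a : ℤ) + (b + 1 : ℕ) = (a + (b + 1) : ℕ) := by omega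
    have e3 : ((a + 1 : ℕ) : ℤ) + (b + 1 : ℕ) = (a + (b + 1) : ℕ) + 1 := by omega
    have e4 : ((a + 1 : ℕ) : ℤ) - 1 = a := by omega
    rw [e3, e1, e2] at h
    rw [e, e4, h]
  · rw [qBinom_eq_zero _ (by omega : ¬ (0 ≤ (m : ℤ) + 1 ∧ (m : ℤ) + 1 ≤ m)), sub_self,
      add_sub_cancel_right, qBinom_self m hq]
    simpa using qBinom_self (m + 1) hq
  -- Here `toNat` truncates a negative exponent, harmlessly, since all three binomials vanish.
  · rw [qBinom_eq_zero, qBinom_eq_zero, qBinom_eq_zero] <;> first | omega | simp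

/-- The other form of the `q`-Pascal rule. -/
theorem qBinom_succ_left' (m : ℕ) (n : ℤ) {q : ℚ⟦X⟧} (hq : PowerSeries.constantCoeff q = 0) :
    qBinom (m + 1) n q = qBinom m (n - 1) q + q ^ n.toNat * qBinom m n q := by
  -- Reflecting the bottom index to `m + 1 - n` turns the exponent `m + 1 - n` into `n`.
  rw [← qBinom_symm, qBinom_succ_left m _ hq, ← qBinom_symm m (n - 1), ← qBinom_symm m n]
  congr 2
  · ring
  · congr 2; ring
  · congr 1; ring

/-! ### The BG-rank as an alternating sum -/

/-- The BG-rank `r_0 - r_1` as an integer. -/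
def bgRank (π : YoungDiagram) : ℤ := ∑ c ∈ π.cells, (-1) ^ (c.1 + c.2)

/-- The label `b - a` and the exponent `a + b` have the same parity. -/
theorem gbgRank_two_eq_bgRank (π : YoungDiagram) : gbgRank π 2 = (bgRank π : ℂ) := by
  have h : bgRank π = (residueCount π 2 0 : ℤ) - (residueCount π 2 1 : ℤ) := by
    unfold bgRank residueCount
    rw [Finset.card_filter, Finset.card_filter]
    push_cast
    rw [← Finset.sum_sub_distrib]
    refine Finset.sum_congr rfl fun c _ => ?_
    rcases Nat.even_or_odd (c.1 + c.2) with he | ho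
    · rw [he.neg_one_pow, if_pos (by grind), if_neg (by grind)]; rfl
    · rw [ho.neg_one_pow, if_neg (by grind), if_pos (by grind)]; rfl
  rw [gbgRank_two, h]
  push_cast
  rfl

/-! ### Principal hooks of self-conjugate diagrams -/

/-- The cells of the hook with corner `(0, 0)` and with arm and leg of length `M`. -/
def hook (M : ℕ) : Finset (ℕ × ℕ) :=
  (Finset.range (M + 1) ×ˢ Finset.range (M + 1)).filter fun c => c.1 = 0 ∨ c.2 = 0

theorem mem_hook {M i j : ℕ} :
    (i, j) ∈ hook M ↔ (i < M + 1 ∧ j < M + 1) ∧ (i = 0 ∨ j = 0) := by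
  simp [hook]

/-- Translation by one step along the main diagonal. -/
def diagShift : ℕ × ℕ ↪ ℕ × ℕ where
  toFun c := (c.1 + 1, c.2 + 1)
  inj' a b h := by
    simp only [Prod.mk.injEq, add_left_inj] at h
    exact Prod.ext h.1 h.2

theorem diagShift_apply (c : ℕ × ℕ) : diagShift c = (c.1 + 1, c.2 + 1) := rfl

theorem disjoint_hook_map_diagShift (M : ℕ) (s : Finset (ℕ × ℕ)) :
    Disjoint (hook M) (s.map diagShift) := by
  rw [Finset.disjoint_left]
  rintro ⟨i, j⟩ h h'
  obtain ⟨c, -, hc⟩ := Finset.mem_map.mp h'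
  rw [mem_hook] at h
  simp only [diagShift_apply, Prod.mk.injEq] at hc
  omega

theorem hook_succ (M : ℕ) : hook (M + 1) = insert (0, M + 1) (insert (M + 1, 0) (hook M)) := by
  ext ⟨i, j⟩
  simp only [Finset.mem_insert, mem_hook, Prod.mk.injEq]
  omega

theorem card_hook (M : ℕ) : (hook M).card = 2 * M + 1 := by
  induction M with
  | zero => rfl
  | succ M ih =>
    rw [hook_succ, Finset.card_insert_of_notMem, Finset.card_insert_of_notMem, ih]
    · ring
    · simp [mem_hook]
    · simp [mem_hook]

/-- Each lengthening adds two cells of sign `(-1)^(M+1)`, and `(-1)^M + 2 (-1)^(M+1) = (-1)^(M+1)`.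
-/
theorem sum_hook (M : ℕ) : ∑ c ∈ hook M, (-1 : ℤ) ^ (c.1 + c.2) = (-1) ^ M := by
  induction M with
  | zero => rfl
  | succ M ih =>
    rw [hook_succ, Finset.sum_insert, Finset.sum_insert, ih]
    · simp only [zero_add, add_zero, pow_succ]; ring
    · simp [mem_hook]
    · simp [mem_hook]

theorem card_of_cells_eq {π ρ : YoungDiagram} {M : ℕ}
    (h : π.cells = hook M ∪ ρ.cells.map diagShift) : π.card = 2 * M + 1 + ρ.card := by
  rw [YoungDiagram.card, h, Finset.card_union_of_disjoint (disjoint_hook_map_diagShift _ _),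
    card_hook, Finset.card_map]

theorem bgRank_of_cells_eq {π ρ : YoungDiagram} {M : ℕ}
    (h : π.cells = hook M ∪ ρ.cells.map diagShift) : bgRank π = (-1) ^ M + bgRank ρ := by
  rw [bgRank, h, Finset.sum_union (disjoint_hook_map_diagShift _ _), sum_hook, Finset.sum_map]
  congr 1
  refine Finset.sum_congr rfl fun c _ => ?_
  simp only [diagShift_apply]
  rw [show c.1 + 1 + (c.2 + 1) = c.1 + c.2 + 2 by ring, pow_add]
  simp

theorem mem_hook_union_map {π : YoungDiagram} {M i j : ℕ} :
    (i, j) ∈ hook M ∪ π.cells.map diagShift ↔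
      ((i < M + 1 ∧ j < M + 1) ∧ (i = 0 ∨ j = 0)) ∨ (0 < i ∧ 0 < j ∧ (i - 1, j - 1) ∈ π) := by
  rw [Finset.mem_union, mem_hook, Finset.mem_map]
  refine or_congr Iff.rfl ⟨?_, ?_⟩
  · rintro ⟨c, hc, h⟩
    simp only [diagShift_apply, Prod.mk.injEq] at h
    obtain ⟨rfl, rfl⟩ := h
    exact ⟨by omega, by omega, hc⟩
  · rintro ⟨hi, hj, h⟩
    refine ⟨_, h, ?_⟩
    simp only [diagShift_apply, Prod.mk.injEq]
    omega

/-- The diagram left after deletion of the first row and the first column. -/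
noncomputable def removeHook (π : YoungDiagram) : YoungDiagram where
  cells := π.cells.preimage diagShift diagShift.injective.injOn
  isLowerSet := by
    intro a b hab ha
    simp only [Finset.coe_preimage, Set.mem_preimage, Finset.mem_coe] at ha ⊢
    exact π.up_left_mem (Nat.succ_le_succ hab.1) (Nat.succ_le_succ hab.2) ha

theorem mem_removeHook {π : YoungDiagram} {i j : ℕ} :
    (i, j) ∈ removeHook π ↔ (i + 1, j + 1) ∈ π := by
  rw [← YoungDiagram.mem_cells]
  exact Finset.mem_preimage (hf := diagShift.injective.injOn)

theorem IsSelfConjugate.mem_comm {π : YoungDiagram} (h : IsSelfConjugate π) {i j : ℕ} :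
    (i, j) ∈ π ↔ (j, i) ∈ π := by
  have h' := YoungDiagram.mem_transpose (μ := π) (c := (i, j))
  rwa [← h] at h'

theorem isSelfConjugate_of_mem_comm {π : YoungDiagram}
    (h : ∀ i j, (i, j) ∈ π → (j, i) ∈ π) : IsSelfConjugate π := by
  refine SetLike.ext fun ⟨i, j⟩ => ?_
  rw [YoungDiagram.mem_transpose]
  exact ⟨h i j, h j i⟩

theorem largestPart_le_iff {π : YoungDiagram} {M : ℕ} :
    largestPart π ≤ M ↔ ∀ i j, (i, j) ∈ π → j < M := by
  constructor
  · intro h i j hc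
    exact (YoungDiagram.mem_iff_lt_rowLen.mp (π.up_left_mem (Nat.zero_le i) le_rfl hc)).trans_le h
  · intro h
    by_contra hlt
    exact lt_irrefl M (h 0 M (YoungDiagram.mem_iff_lt_rowLen.mpr (not_le.mp hlt)))

/-- Adds a first row and a first column of length `M + 1` each. -/
def addHook (M : ℕ) (π : YoungDiagram) (hs : IsSelfConjugate π) (hl : largestPart π ≤ M) :
    YoungDiagram where
  cells := hook M ∪ π.cells.map diagShift
  isLowerSet := by
    rintro ⟨i, j⟩ ⟨i', j'⟩ ⟨hi, hj⟩ h
    simp only [Finset.mem_coe, mem_hook_union_map] at h ⊢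
    simp only at hi hj
    rcases h with h | ⟨h1, h2, h3⟩
    · left; omega
    -- Self-conjugacy bounds the rows as `hl` bounds the columns, so the new first row and column
    -- reach past every shifted cell.
    · have hj1 := largestPart_le_iff.mp hl _ _ h3
      have hi1 := largestPart_le_iff.mp hl _ _ (hs.mem_comm.mp h3)
      by_cases h0 : i' = 0 ∨ j' = 0
      · left; omega
      · right
        exact ⟨by omega, by omega, π.up_left_mem (by omega) (by omega) h3⟩

theorem mem_addHook {M : ℕ} {π : YoungDiagram} {hs : IsSelfConjugate π} {hl : largestPart π ≤ M}
    {i j : ℕ} : (i, j) ∈ addHook M π hs hl ↔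
      ((i < M + 1 ∧ j < M + 1) ∧ (i = 0 ∨ j = 0)) ∨ (0 < i ∧ 0 < j ∧ (i - 1, j - 1) ∈ π) := by
  rw [← YoungDiagram.mem_cells]
  exact mem_hook_union_map

theorem isSelfConjugate_addHook {M : ℕ} {π : YoungDiagram} (hs : IsSelfConjugate π)
    (hl : largestPart π ≤ M) : IsSelfConjugate (addHook M π hs hl) := by
  refine isSelfConjugate_of_mem_comm fun i j h => ?_
  rw [mem_addHook] at h ⊢
  rw [hs.mem_comm]
  tauto

theorem largestPart_addHook {M : ℕ} {π : YoungDiagram} (hs : IsSelfConjugate π)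
    (hl : largestPart π ≤ M) : largestPart (addHook M π hs hl) = M + 1 := by
  refine le_antisymm (largestPart_le_iff.mpr fun _ _ h => ?_)
    (YoungDiagram.mem_iff_lt_rowLen.mp (mem_addHook.mpr (by omega)))
  rcases mem_addHook.mp h with h | ⟨-, -, h⟩
  · exact h.1.2
  · have := largestPart_le_iff.mp hl _ _ h
    omega

theorem removeHook_addHook {M : ℕ} {π : YoungDiagram} (hs : IsSelfConjugate π)
    (hl : largestPart π ≤ M) : removeHook (addHook M π hs hl) = π := by
  refine SetLike.ext fun ⟨i, j⟩ => ?_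
  rw [mem_removeHook, mem_addHook]
  simp

theorem IsSelfConjugate.removeHook {π : YoungDiagram} (h : IsSelfConjugate π) :
    IsSelfConjugate (removeHook π) :=
  isSelfConjugate_of_mem_comm fun i j hc => by
    rw [mem_removeHook] at hc ⊢
    exact h.mem_comm.mp hc

theorem largestPart_removeHook_le {π : YoungDiagram} {M : ℕ} (h : largestPart π ≤ M + 1) :
    largestPart (removeHook π) ≤ M :=
  largestPart_le_iff.mpr fun _ _ hc =>
    Nat.lt_of_succ_lt_succ (largestPart_le_iff.mp h _ _ (mem_removeHook.mp hc))

theorem cells_eq_hook_union {π : YoungDiagram} {M : ℕ} (hs : IsSelfConjugate π)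
    (hl : largestPart π = M + 1) :
    π.cells = hook M ∪ (removeHook π).cells.map diagShift := by
  have h0 : ∀ j, (0, j) ∈ π ↔ j < M + 1 := fun j => by
    rw [YoungDiagram.mem_iff_lt_rowLen, ← hl]; rfl
  ext ⟨i, j⟩
  rw [mem_hook_union_map, YoungDiagram.mem_cells, mem_removeHook]
  rcases i with _ | i
  · rw [h0]; simp
  rcases j with _ | j
  · rw [hs.mem_comm, h0]; simp
  · simp

/-! ### The recurrence for the generating function -/

theorem mem_selfConjugateSet_two {N : ℕ} {k : ℤ} {π : YoungDiagram} :
    π ∈ selfConjugateSet N 2 k ↔ IsSelfConjugate π ∧ bgRank π = k ∧ largestPart π ≤ N := by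
  rw [selfConjugateSet, Set.mem_ofPred_eq, gbgRank_two_eq_bgRank, Int.cast_inj]

/-- `removeHook` is a bijection between the two sets, with inverse `addHook M`. -/
theorem ncard_largestPart_eq (M n : ℕ) (k : ℤ) :
    {π ∈ selfConjugateSet (M + 1) 2 k | π.card = 2 * M + 1 + n ∧ largestPart π = M + 1}.ncard =
      {π ∈ selfConjugateSet M 2 (k - (-1) ^ M) | π.card = n}.ncard := by
  refine Set.BijOn.ncard_eq (f := removeHook) ⟨?_, ?_, ?_⟩
  · rintro π ⟨hπ, hc, hl⟩
    obtain ⟨hs, hk, -⟩ := mem_selfConjugateSet_two.mp hπ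
    have h := cells_eq_hook_union hs hl
    have h1 := card_of_cells_eq h
    have h2 := bgRank_of_cells_eq h
    exact ⟨mem_selfConjugateSet_two.mpr
      ⟨hs.removeHook, by linarith, largestPart_removeHook_le hl.le⟩, by omega⟩
  · rintro π ⟨hπ, -, hl⟩ ρ ⟨hρ, -, hl'⟩ h
    refine YoungDiagram.ext ?_
    rw [cells_eq_hook_union (mem_selfConjugateSet_two.mp hπ).1 hl,
      cells_eq_hook_union (mem_selfConjugateSet_two.mp hρ).1 hl', h]
  · rintro π ⟨hπ, hc⟩
    obtain ⟨hs, hk, hl⟩ := mem_selfConjugateSet_two.mp hπ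
    have h1 : (addHook M π hs hl).card = _ := card_of_cells_eq rfl
    have h2 : bgRank (addHook M π hs hl) = _ := bgRank_of_cells_eq rfl
    exact ⟨addHook M π hs hl, ⟨mem_selfConjugateSet_two.mpr
      ⟨isSelfConjugate_addHook hs hl, by linarith, (largestPart_addHook hs hl).le⟩, by omega,
      largestPart_addHook hs hl⟩, removeHook_addHook hs hl⟩

theorem ncard_selfConjugateSet_succ (M n : ℕ) (k : ℤ) :
    {π ∈ selfConjugateSet (M + 1) 2 k | π.card = n}.ncard =
      {π ∈ selfConjugateSet M 2 k | π.card = n}.ncard +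
      {π ∈ selfConjugateSet (M + 1) 2 k | π.card = n ∧ largestPart π = M + 1}.ncard := by
  rw [← Set.ncard_union_eq ?_ ((selfConjugateSet_finite M 2 k).subset (Set.sep_subset _ _))
    ((selfConjugateSet_finite (M + 1) 2 k).subset (Set.sep_subset _ _))]
  · congr 1
    ext π
    simp only [Set.mem_union, Set.mem_ofPred_eq, mem_selfConjugateSet_two, Nat.le_succ_iff]
    tauto
  · rw [Set.disjoint_left]
    rintro π ⟨hπ, -⟩ ⟨-, -, hl⟩
    have := (mem_selfConjugateSet_two.mp hπ).2.2
    omega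

theorem GSC_succ (M : ℕ) (k : ℤ) :
    GSC (M + 1) 2 k =
      GSC M 2 k + PowerSeries.X ^ (2 * M + 1) * GSC M 2 (k - (-1) ^ M) := by
  ext n
  rw [map_add, PowerSeries.coeff_X_pow_mul']
  simp only [GSC, PowerSeries.coeff_mk]
  rw [ncard_selfConjugateSet_succ, Nat.cast_add]
  congr 1
  split_ifs with h
  · obtain ⟨n, rfl⟩ := Nat.exists_eq_add_of_le h
    rw [ncard_largestPart_eq, Nat.add_sub_cancel_left]
  -- In degrees below `2 * M + 1` there is no room for the principal hook.
  · rw [Nat.cast_eq_zero, Set.ncard_eq_zero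
      ((selfConjugateSet_finite (M + 1) 2 k).subset (Set.sep_subset _ _))]
    refine Set.eq_empty_of_forall_notMem ?_
    rintro π ⟨hπ, hc, hl⟩
    have := card_of_cells_eq (cells_eq_hook_union (mem_selfConjugateSet_two.mp hπ).1 hl)
    omega

theorem GSC_zero (k : ℤ) : GSC 0 2 k = if k = 0 then 1 else 0 := by
  have hbot : ∀ π : YoungDiagram, largestPart π ≤ 0 ↔ π = ⊥ := fun π => by
    rw [largestPart_le_iff]
    constructor
    · intro h
      exact SetLike.ext fun ⟨i, j⟩ => by simpa using fun hc => absurd (h i j hc) (by omega)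
    · rintro rfl
      simp
  have hs : IsSelfConjugate ⊥ := isSelfConjugate_of_mem_comm (by simp)
  have hset : ∀ n, {π ∈ selfConjugateSet 0 2 k | π.card = n} =
      if k = 0 ∧ n = 0 then {⊥} else ∅ := fun n => by
    ext π
    simp only [Set.mem_ofPred_eq, mem_selfConjugateSet_two, hbot]
    have h1 : bgRank ⊥ = 0 := rfl
    have h2 : (⊥ : YoungDiagram).card = 0 := rfl
    constructor
    · rintro ⟨⟨-, hk, rfl⟩, hn⟩
      rw [if_pos ⟨hk.symm.trans h1, hn.symm.trans h2⟩]
      rfl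
    · split_ifs with h
      · rintro rfl
        exact ⟨⟨hs, h1.trans h.1.symm, rfl⟩, h2.trans h.2.symm⟩
      · exact False.elim
  ext n
  rw [GSC, PowerSeries.coeff_mk, hset]
  by_cases hk : k = 0 <;> by_cases hn : n = 0 <;> simp [hk, hn, PowerSeries.coeff_one]

/-! ### Comparison of the two recurrences -/

theorem X_pow_mul_qBinom_odd (N : ℕ) (k : ℤ) :
    (PowerSeries.X : ℚ⟦X⟧) ^ (2 * k ^ 2 - k).toNat *
        qBinom (2 * N + 1) (N + k) (PowerSeries.X ^ 4) =
      PowerSeries.X ^ (2 * k ^ 2 - k).toNat * qBinom (2 * N) (N + k) (PowerSeries.X ^ 4) +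
      PowerSeries.X ^ (2 * (2 * N) + 1) * (PowerSeries.X ^ (2 * (k - 1) ^ 2 - (k - 1)).toNat *
        qBinom (2 * N) (N + (k - 1)) (PowerSeries.X ^ 4)) := by
  have h := qBinom_succ_left (2 * N) (N + k) (q := (PowerSeries.X : ℚ⟦X⟧) ^ 4) (by simp)
  push_cast at h
  rw [h, mul_add, show (N + k - 1 : ℤ) = N + (k - 1) by ring]
  congr 1
  -- Within range every `toNat` is exact, and the exponents agree: `2k² - k + 4(N + 1 - k) = 4N + 1
  -- + 2(k-1)² - (k-1)`. Outside it both terms vanish.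
  by_cases hr : 0 ≤ (N : ℤ) + (k - 1) ∧ (N : ℤ) + (k - 1) ≤ 2 * N
  · rw [← mul_assoc, ← mul_assoc, ← pow_mul, ← pow_add, ← pow_add]
    congr 2
    have h1 : 0 ≤ 2 * k ^ 2 - k := by nlinarith [Int.le_self_sq k, sq_nonneg k]
    have h2 : 0 ≤ 2 * (k - 1) ^ 2 - (k - 1) := by
      nlinarith [Int.le_self_sq (k - 1), sq_nonneg (k - 1)]
    have h3 : 0 ≤ 2 * (N : ℤ) + 1 - (N + k) := by omega
    zify
    rw [Int.toNat_of_nonneg h1, Int.toNat_of_nonneg h2, Int.toNat_of_nonneg h3]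
    ring
  · rw [qBinom_eq_zero _ hr]
    simp

theorem X_pow_mul_qBinom_even (N : ℕ) (k : ℤ) :
    (PowerSeries.X : ℚ⟦X⟧) ^ (2 * k ^ 2 - k).toNat *
        qBinom (2 * N + 2) (N + 1 + k) (PowerSeries.X ^ 4) =
      PowerSeries.X ^ (2 * k ^ 2 - k).toNat * qBinom (2 * N + 1) (N + k) (PowerSeries.X ^ 4) +
      PowerSeries.X ^ (2 * (2 * N + 1) + 1) *
        (PowerSeries.X ^ (2 * (k + 1) ^ 2 - (k + 1)).toNat *
        qBinom (2 * N + 1) (N + (k + 1)) (PowerSeries.X ^ 4)) := by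
  have h := qBinom_succ_left' (2 * N + 1) (N + 1 + k) (q := (PowerSeries.X : ℚ⟦X⟧) ^ 4) (by simp)
  push_cast at h
  rw [show (2 * N + 2 : ℤ) = 2 * N + 1 + 1 by ring, h, mul_add,
    show (N + 1 + k - 1 : ℤ) = N + k by ring, show (N + 1 + k : ℤ) = N + (k + 1) by ring]
  congr 1
  -- As in the odd case, now with `2k² - k + 4(N + 1 + k) = 4N + 3 + 2(k+1)² - (k+1)`.
  by_cases hr : 0 ≤ (N : ℤ) + (k + 1) ∧ (N : ℤ) + (k + 1) ≤ 2 * N + 1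
  · rw [← mul_assoc, ← mul_assoc, ← pow_mul, ← pow_add, ← pow_add]
    congr 2
    have h1 : 0 ≤ 2 * k ^ 2 - k := by nlinarith [Int.le_self_sq k, sq_nonneg k]
    have h2 : 0 ≤ 2 * (k + 1) ^ 2 - (k + 1) := by
      nlinarith [Int.le_self_sq (k + 1), sq_nonneg (k + 1)]
    zify
    rw [Int.toNat_of_nonneg h1, Int.toNat_of_nonneg h2, Int.toNat_of_nonneg hr.1]
    ring
  · rw [qBinom_eq_zero _ hr]
    simp

/-- Used twice: as the first half of the induction step from `2 * N` to `2 * N + 2`, and for the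
case `ν = 1`. -/
theorem GSC_odd_of_even {N : ℕ}
    (ih : ∀ k : ℤ, GSC (2 * N) 2 k = PowerSeries.X ^ (2 * k ^ 2 - k).toNat *
      qBinom (2 * N) (N + k) (PowerSeries.X ^ 4)) (k : ℤ) :
    GSC (2 * N + 1) 2 k = PowerSeries.X ^ (2 * k ^ 2 - k).toNat *
      qBinom (2 * N + 1) (N + k) (PowerSeries.X ^ 4) := by
  rw [GSC_succ, (even_two_mul N).neg_one_pow, ih, ih, X_pow_mul_qBinom_odd]

theorem GSC_even (N : ℕ) (k : ℤ) :
    GSC (2 * N) 2 k = PowerSeries.X ^ (2 * k ^ 2 - k).toNat *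
      qBinom (2 * N) (N + k) (PowerSeries.X ^ 4) := by
  -- The recurrence shifts `k`, so the hypothesis must hold for all `k`.
  induction N generalizing k with
  | zero =>
    rw [Nat.mul_zero, GSC_zero]
    split_ifs with hk
    · subst hk
      have h := qBinom_zero_right 0 (q := (PowerSeries.X : ℚ⟦X⟧) ^ 4) (by simp)
      simpa using h.symm
    · rw [qBinom_eq_zero _ (by push_cast; omega), mul_zero]
  | succ N ih =>
    rw [show 2 * (N + 1) = 2 * N + 1 + 1 by ring, GSC_succ, (odd_two_mul_add_one N).neg_one_pow,
      sub_neg_eq_add, GSC_odd_of_even ih, GSC_odd_of_even ih, ← X_pow_mul_qBinom_even]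
    push_cast
    ring_nf

end GBGRank

/-- The exponent `2 * k ^ 2 - k` is non-negative for every integer `k`, so `Int.toNat` only
changes its type. -/
theorem theorem2p2 (N : ℕ) (k : ℤ) (ν : ℕ) (hν : ν = 0 ∨ ν = 1) :
    GBGRank.GSC (2 * N + ν) 2 k =
      (PowerSeries.X : PowerSeries ℚ) ^ (2 * k ^ 2 - k).toNat *
        GBGRank.qBinom (2 * (N : ℤ) + (ν : ℤ)) ((N : ℤ) + k)
          ((PowerSeries.X : PowerSeries ℚ) ^ 4) := by
  rcases hν with rfl | rfl
  · simpa using GBGRank.GSC_even N k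
  · simpa using GBGRank.GSC_odd_of_even (GBGRank.GSC_even N) k
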